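/- Let $K$ be a field and let $n,k$ be integers with $1\le k\le n-1$. Let $D$ be the lattice of divisors of $2\cdot 3^{n-1}$ ordered by divisibility, with elements $x_i=3^{i-1}$ and $y_i=2\cdot 3^{i-1}$ for $1\le i\le n$. Let $L_k=D\cup\{z\}$ be the lattice obtained from $D$ by adding one new element $z$ in the interval $[x_k,y_{k+1}]$, so that $x_k<x_{k+1},\,z,\,y_k<y_{k+1}$ is a diamond: the order on $D$ is unchanged and, for $a,b\in D$, one has $a\le z$ if and only if $a\le x_k$, and $z\le b$ if and only if $y_{k+1}\le b$. Let $I_{L_k}$ be the join-meet ideal of $L_k$, that is, the ideal of the polynomial ring $K[L_k]=K[x_1,\dots,x_n,y_1,\dots,y_n,z]$ generated by all binomials $ab-(a\wedge b)(a\vee b)$ with $a,b\in L_k$ incomparable. Then $I_{L_k}$ is a radical ideal. -/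

import Mathlib

/-- The join-meet ideal `I_L` of a lattice `L` over `K`: the ideal of the polynomial ring `K[L]`,
whose variables are the elements of `L`, generated by the binomials `ab - (a ⊓ b)(a ⊔ b)` for
`a, b ∈ L` incomparable. -/
noncomputable def joinMeetIdeal (K : Type*) [CommRing K] (L : Type*) [Lattice L] :
    Ideal (MvPolynomial L K) :=
  Ideal.span {f | ∃ a b : L, ¬ a ≤ b ∧ ¬ b ≤ a ∧
    f = MvPolynomial.X a * MvPolynomial.X b
        - MvPolynomial.X (a ⊓ b) * MvPolynomial.X (a ⊔ b)}

/-- The elements `x_1, …, x_n, y_1, …, y_n, z` of the lattice `L_k`, for `1 ≤ k ≤ n - 1`.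
Indices in `Fin n` start at `0`: the element `x i` is the mathematical `x_{i+1}`, and `y i` is
`y_{i+1}`. The elements `x i` and `y i` make up the distributive lattice `D`: the element `x i`
is the divisor `3 ^ i` and `y i` is the divisor `2 * 3 ^ i`. -/
inductive DiamondLattice (n k : ℕ) : Type
  | x (i : Fin n) : DiamondLattice n k
  | y (i : Fin n) : DiamondLattice n k
  | z : DiamondLattice n k

namespace DiamondLattice

variable {n k : ℕ}

/-- The order of `L_k`: divisibility on `D`; and the new element `z` is placed exactly between
`x_k` and `y_{k+1}`, that is, `a ≤ z` iff `a ≤ x_k`, and `z ≤ b` iff `y_{k+1} ≤ b`, for `a, b` in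
`D`. -/
protected def le : DiamondLattice n k → DiamondLattice n k → Prop
  | x i, x j => i ≤ j
  | x i, y j => i ≤ j
  | y _, x _ => False
  | y i, y j => i ≤ j
  | x i, z => i.val < k
  | y _, z => False
  | z, x _ => False
  | z, y j => k ≤ j.val
  | z, z => True

/-- The join of `L_k`, for `k ≤ n - 1`. -/
protected def sup (hkn : k + 1 ≤ n) : DiamondLattice n k → DiamondLattice n k →
    DiamondLattice n k
  | x i, x j => x (max i j)
  | x i, y j => y (max i j)
  | y i, x j => y (max i j)
  | y i, y j => y (max i j)
  | x i, z => if i.val < k then z else y i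
  | z, x i => if i.val < k then z else y i
  | y i, z => y (max i ⟨k, hkn⟩)
  | z, y i => y (max i ⟨k, hkn⟩)
  | z, z => z

/-- The meet of `L_k`, for `k ≤ n - 1`. -/
protected def inf (hkn : k + 1 ≤ n) : DiamondLattice n k → DiamondLattice n k →
    DiamondLattice n k
  | x i, x j => x (min i j)
  | x i, y j => x (min i j)
  | y i, x j => x (min i j)
  | y i, y j => y (min i j)
  | x i, z => x (min i ⟨k - 1, by omega⟩)
  | z, x i => x (min i ⟨k - 1, by omega⟩)
  | y i, z => if k ≤ i.val then z else x i
  | z, y i => if k ≤ i.val then z else x i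
  | z, z => z

instance : PartialOrder (DiamondLattice n k) where
  le := DiamondLattice.le
  le_refl a := by
    cases a <;> simp [DiamondLattice.le]
  le_trans a b c := by
    cases a <;> cases b <;> cases c <;> simp only [DiamondLattice.le, Fin.le_def] <;> grind
  le_antisymm a b := by
    cases a <;> cases b <;>
      simp only [DiamondLattice.le, Fin.le_def, x.injEq, y.injEq, Fin.ext_iff] <;> grind

/-- The lattice `L_k`, for `1 ≤ k ≤ n - 1`. -/
@[reducible]
def lattice (hk : 1 ≤ k) (hkn : k + 1 ≤ n) : Lattice (DiamondLattice n k) where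
  sup := DiamondLattice.sup hkn
  inf := DiamondLattice.inf hkn
  le_sup_left a b := by
    change DiamondLattice.le _ _
    cases a <;> cases b <;> simp only [DiamondLattice.sup] <;> (try split_ifs) <;>
      simp only [DiamondLattice.le, Fin.le_def, Fin.coe_max] <;> grind
  le_sup_right a b := by
    change DiamondLattice.le _ _
    cases a <;> cases b <;> simp only [DiamondLattice.sup] <;> (try split_ifs) <;>
      simp only [DiamondLattice.le, Fin.le_def, Fin.coe_max] <;> grind
  sup_le a b c := by
    change DiamondLattice.le _ _ → DiamondLattice.le _ _ → DiamondLattice.le _ _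
    cases a <;> cases b <;> cases c <;> simp only [DiamondLattice.sup] <;> (try split_ifs) <;>
      simp only [DiamondLattice.le, Fin.le_def, Fin.coe_max] <;> grind
  inf_le_left a b := by
    change DiamondLattice.le _ _
    cases a <;> cases b <;> simp only [DiamondLattice.inf] <;> (try split_ifs) <;>
      simp only [DiamondLattice.le, Fin.le_def, Fin.coe_min] <;> grind
  inf_le_right a b := by
    change DiamondLattice.le _ _
    cases a <;> cases b <;> simp only [DiamondLattice.inf] <;> (try split_ifs) <;>
      simp only [DiamondLattice.le, Fin.le_def, Fin.coe_min] <;> grind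
  le_inf a b c := by
    change DiamondLattice.le _ _ → DiamondLattice.le _ _ → DiamondLattice.le _ _
    cases a <;> cases b <;> cases c <;> simp only [DiamondLattice.inf] <;> (try split_ifs) <;>
      simp only [DiamondLattice.le, Fin.le_def, Fin.coe_min] <;> grind

end DiamondLattice

/-!
Write `p = k - 1` and `q = k` for the two positions of the diamond, counted from zero. Modulo the
join-meet ideal `I` the `x i` and `y i` satisfy the `2 × 2` minors of the matrix with rows `x` and
`y`, and in addition `z * x j = x p * y j` for `j ≥ k` and `z * y i = x i * y q` for `i < k`. The
zero set of `I` is a union of toric varieties: six of them are cut out of the Segre variety (with a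
free coordinate `z`) by setting to zero all variables outside a "face", and the last one is the
scroll obtained from the Segre variety by `z = x q = y p`. Each is the zero set of the kernel of
a homomorphism to a polynomial ring that sends variables to monomials or to zero
(`MvPolynomial.toricHom`), so the radical of `I` is contained in each of these kernels, and it is
enough to show that an element of all of them lies in `I`.

Since `I` is generated by differences of monomials, this comes down to comparing monomials modulo
`I`. The minors alone show that monomials with the same image in the Segre ring are congruent
(`DiamondLattice.Relations.prod_eq_of_segre`); hence the part of `f ∈ √I` supported on a face lies
in `I`, and can be removed. A monomial that is not supported on any face is congruent to a multiple
of some `x i * y j` with `i < k ≤ j` (`DiamondLattice.exists_cons_cons_of_not_isFace`). Such a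
product satisfies `x i * y j * z = x i * y j * x q = x i * y j * y p`, so after multiplication by it
all relations of the scroll hold; therefore two monomials off the faces with the same image in
the scroll are congruent (`DiamondLattice.Relations.prod_eq_of_scroll`), and what is left of `f`
lies in `I` because the scroll homomorphism kills it. Both comparisons of monomials rest on the same
straightening argument, `prod_eq_of_map_eq_of_sum_eq`.
-/

/-! ### Exchange of factors in products of graded elements -/

/-- Straightening in a rational normal scroll. The variables `v` are sorted into blocks `β v`, and
within a block by a weight `w v` between `0` and the top weight of the block. If raising one factor
by one weight step while lowering another does not change products, then a product depends only on
the blocks of its factors and on their total weight. All equalities are multiplied by a fixed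
element `c`, so that the statement also applies modulo the annihilator of `c`. -/
theorem prod_eq_of_map_eq_of_sum_eq {V B A : Type*} [CommMonoid A] {g : V → A} {c : A}
    {β : V → B} {w : V → ℕ} (top : B → ℕ) (hle : ∀ v, w v ≤ top (β v))
    (hcongr : ∀ u v, β u = β v → w u = w v → c * g u = c * g v)
    (hexch : ∀ u v, w u < top (β u) → 0 < w v → ∃ u' v', β u' = β u ∧ w u' = w u + 1 ∧
      β v' = β v ∧ w v' + 1 = w v ∧ c * (g u * g v) = c * (g u' * g v'))
    {s t : Multiset V} (hβ : s.map β = t.map β) (hw : (s.map w).sum = (t.map w).sum) :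
    c * (s.map g).prod = c * (t.map g).prod := by
  induction hN : Multiset.card s generalizing s t with
  | zero =>
    obtain rfl := Multiset.card_eq_zero.1 hN
    obtain rfl : t = 0 := by simpa using hβ.symm
    rfl
  | succ N ih =>
    -- The case of a chosen pair of factors in the same block, by induction on the weight gap.
    have key : ∀ (d : ℕ) (u v : V) (s t : Multiset V), Multiset.card s = N → β u = β v →
        w v = w u + d → s.map β = t.map β →
        w u + (s.map w).sum = w v + (t.map w).sum →
        c * (g u * (s.map g).prod) = c * (g v * (t.map g).prod) := by
      intro d
      induction d with
      | zero =>
        intro u v s t hs huv hd hβ hw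
        have h1 := ih hβ (by omega) hs
        have h2 := hcongr u v huv (by omega)
        calc c * (g u * (s.map g).prod) = g u * (c * (s.map g).prod) := by ac_rfl
          _ = (c * g u) * (t.map g).prod := by rw [h1]; ac_rfl
          _ = c * (g v * (t.map g).prod) := by rw [h2, mul_assoc]
      | succ d ihd =>
        intro u v s t hs huv hd hβ hw
        -- The total weight of `t` is below that of `s`, so some factor of `t` can be raised.
        obtain ⟨r, hr, hrt⟩ : ∃ r ∈ t, w r < top (β r) := by
          by_contra! hcon
          have h1 : (s.map w).sum ≤ (s.map fun v => top (β v)).sum :=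
            Multiset.sum_map_le_sum_map _ _ fun v _ => hle v
          have h2 : (t.map fun v => top (β v)).sum ≤ (t.map w).sum :=
            Multiset.sum_map_le_sum_map _ _ hcon
          have h3 : (s.map fun v => top (β v)).sum = (t.map fun v => top (β v)).sum := by
            have := congrArg (fun m => (m.map top).sum) hβ
            simpa [Multiset.map_map, Function.comp_def] using this
          omega
        obtain ⟨t, rfl⟩ := Multiset.exists_cons_of_mem hr
        obtain ⟨r', v', h1, h2, h3, h4, h5⟩ := hexch r v hrt (by omega)
        have := ihd u v' s (r' ::ₘ t) hs (huv.trans h3.symm) (by omega)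
          (by simpa [h1] using hβ)
          (by simp only [Multiset.map_cons, Multiset.sum_cons] at hw ⊢; omega)
        rw [this]
        simp only [Multiset.map_cons, Multiset.prod_cons]
        calc c * (g v' * (g r' * (t.map g).prod))
            = (c * (g r' * g v')) * (t.map g).prod := by ac_rfl
          _ = c * (g v * (g r * (t.map g).prod)) := by rw [← h5]; ac_rfl
    obtain ⟨u, hu⟩ : ∃ u, u ∈ s := Multiset.card_pos_iff_exists_mem.1 (by omega)
    obtain ⟨v, hv, huv⟩ : ∃ v ∈ t, β v = β u := by
      rw [← Multiset.mem_map, ← hβ]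
      exact Multiset.mem_map_of_mem β hu
    obtain ⟨s, rfl⟩ := Multiset.exists_cons_of_mem hu
    obtain ⟨t, rfl⟩ := Multiset.exists_cons_of_mem hv
    simp only [Multiset.map_cons, Multiset.sum_cons, Multiset.prod_cons, Multiset.card_cons,
      huv, Multiset.cons_inj_right, Nat.add_right_cancel_iff] at hβ hw hN ⊢
    rcases le_total (w u) (w v) with h | h
    · exact key (w v - w u) u v s t hN huv.symm (by omega) hβ hw
    · refine (key (w u - w v) v u t s ?_ huv (by omega) hβ.symm hw.symm).symm
      rw [← hN, ← Multiset.card_map β t, ← hβ, Multiset.card_map]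

/-! ### Homomorphisms to toric components -/

namespace MvPolynomial

variable {V B K : Type*} [Field K]

open Classical in
/-- The homomorphism that sends a variable `v ∈ F` to `X (β v) * T ^ w v`, where `T` is the extra
variable `X none`, and the variables outside `F` to zero. Its kernel is a prime ideal. -/
noncomputable def toricHom (K : Type*) [Field K] (F : Set V) (β : V → B) (w : V → ℕ) :
    MvPolynomial V K →ₐ[K] MvPolynomial (Option B) K :=
  aeval fun v => if v ∈ F then X (some (β v)) * X none ^ w v else 0

/-- The exponent of the image of the monomial `X ^ m` under `toricHom K F β w`, when this image is
not zero. -/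
noncomputable def toricExponent (β : V → B) (w : V → ℕ) (m : V →₀ ℕ) : Option B →₀ ℕ :=
  m.mapDomain (fun v => some (β v)) + Finsupp.single none (Finsupp.weight w m)

theorem toricExponent_eq_iff {β : V → B} {w : V → ℕ} {m m' : V →₀ ℕ} :
    toricExponent β w m = toricExponent β w m' ↔
      m.toMultiset.map β = m'.toMultiset.map β ∧
        (m.toMultiset.map w).sum = (m'.toMultiset.map w).sum := by
  have hsum : ∀ m : V →₀ ℕ, (m.toMultiset.map w).sum = Finsupp.weight w m := by
    intro m
    induction m using Finsupp.induction_linear with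
    | zero => simp
    | add f g hf hg => simp [hf, hg]
    | single v a => simp [Finsupp.weight_apply, Multiset.map_nsmul, Multiset.sum_nsmul]
  have hnone : ∀ m : V →₀ ℕ, (m.mapDomain fun v => some (β v)) none = 0 := fun m =>
    Finsupp.mapDomain_of_notMem_range _ _ (by simp)
  have hmap : ∀ m : V →₀ ℕ, (m.mapDomain fun v => some (β v)) = (m.mapDomain β).mapDomain some :=
    fun m => Finsupp.mapDomain_comp
  have hinj : Function.Injective (Finsupp.toMultiset : (B →₀ ℕ) → Multiset B) := by
    classical
    exact Finsupp.orderIsoMultiset.injective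
  simp only [hsum]
  simp only [Finsupp.toMultiset_map, hinj.eq_iff, toricExponent]
  constructor
  · intro h
    have h0 : Finsupp.weight w m = Finsupp.weight w m' := by
      have := DFunLike.congr_fun h none
      simpa [hnone] using this
    rw [h0, add_left_inj, hmap, hmap] at h
    exact ⟨Finsupp.mapDomain_injective (Option.some_injective _) h, h0⟩
  · rintro ⟨h1, h2⟩
    rw [hmap, hmap, h1, h2]

open Classical in
theorem toricHom_monomial (F : Set V) (β : V → B) (w : V → ℕ) (m : V →₀ ℕ) (a : K) :
    toricHom K F β w (monomial m a) =
      if (m.support : Set V) ⊆ F then monomial (toricExponent β w m) a else 0 := by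
  rw [toricHom, aeval_monomial]
  split_ifs with h
  · have hX : (m.prod fun v k => (if v ∈ F then X (some (β v)) * X none ^ w v else 0 :
        MvPolynomial (Option B) K) ^ k) = monomial (toricExponent β w m) 1 := by
      rw [Finsupp.prod_congr (g2 := fun v k => monomial (toricExponent β w (Finsupp.single v k))
        (1 : K))]
      · have hadd : ∀ m m', toricExponent β w (m + m') =
            toricExponent β w m + toricExponent β w m' := by
          intro m m'
          simp only [toricExponent, Finsupp.mapDomain_add, map_add, Finsupp.single_add]
          abel
        have hzero : toricExponent β w 0 = 0 := by simp [toricExponent]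
        let e : (V →₀ ℕ) →+ (Option B →₀ ℕ) := ⟨⟨toricExponent β w, hzero⟩, hadd⟩
        rw [Finsupp.prod, ← monomial_sum_one]
        refine congrArg (fun e => monomial e (1 : K)) ?_
        conv_rhs => rw [← Finsupp.sum_single m]
        exact (map_sum e _ _).symm
      · intro v hv
        rw [if_pos (h hv), mul_pow, ← pow_mul, X_pow_eq_monomial, X_pow_eq_monomial, monomial_mul]
        simp [toricExponent, Finsupp.weight_apply, mul_comm]
    rw [hX, algebraMap_eq, C_mul_monomial, mul_one]
  · obtain ⟨v, hv, hvF⟩ := Set.not_subset.1 h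
    rw [Finsupp.prod, Finset.prod_eq_zero hv, mul_zero]
    rw [if_neg hvF, zero_pow (Finsupp.mem_support_iff.1 hv)]

open Classical in
/-- If `f` is killed by a toric homomorphism, and two monomials of `f` with the same toric exponent
are congruent modulo `I`, then the part of `f` supported on the face `F` lies in `I`: on each fibre
of the toric exponent the coefficients of that part add up to zero. -/
theorem sum_filter_mem_of_toricHom_eq_zero {I : Ideal (MvPolynomial V K)} {F : Set V} {β : V → B}
    {w : V → ℕ} {f : MvPolynomial V K} (hf : toricHom K F β w f = 0)
    (hI : ∀ m ∈ f.support, ∀ m' ∈ f.support, toricExponent β w m = toricExponent β w m' →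
      (monomial m 1 - monomial m' 1 : MvPolynomial V K) ∈ I) :
    ∑ m ∈ f.support with (m.support : Set V) ⊆ F, monomial m (f.coeff m) ∈ I := by
  set S := f.support.filter fun m => (m.support : Set V) ⊆ F with hS
  have hmon : ∀ m a, monomial m a = C a * (monomial m 1 : MvPolynomial V K) := by
    intro m a; rw [C_mul_monomial, mul_one]
  rw [← Finset.sum_fiberwise_of_maps_to (t := S.image (toricExponent β w))
    (g := toricExponent β w) (fun m hm => Finset.mem_image_of_mem _ hm)]
  refine Ideal.sum_mem _ fun e he => ?_
  obtain ⟨m₀, hm₀, rfl⟩ := Finset.mem_image.1 he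
  have hcoeff : ∑ m ∈ S with toricExponent β w m = toricExponent β w m₀, f.coeff m = 0 := by
    have h := congrArg (coeff (toricExponent β w m₀)) hf
    conv_lhs at h => rw [f.as_sum]
    simp only [map_sum, toricHom_monomial, coeff_sum, coeff_zero] at h
    rw [← h, hS, Finset.filter_filter, Finset.sum_filter]
    refine Finset.sum_congr rfl fun m _ => ?_
    by_cases h1 : (m.support : Set V) ⊆ F <;> simp [h1, coeff_monomial]
  have : ∑ m ∈ S with toricExponent β w m = toricExponent β w m₀, monomial m (f.coeff m) =
      ∑ m ∈ S with toricExponent β w m = toricExponent β w m₀,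
        C (f.coeff m) * (monomial m 1 - monomial m₀ 1) := by
    simp only [mul_sub, Finset.sum_sub_distrib, ← Finset.sum_mul, ← map_sum, hcoeff, map_zero,
      zero_mul, sub_zero]
    exact Finset.sum_congr rfl fun m _ => hmon _ _
  rw [this]
  refine Ideal.sum_mem _ fun m hm => I.mul_mem_left _ ?_
  simp only [hS, Finset.mem_filter] at hm hm₀
  exact hI m hm.1.1 m₀ hm₀.1 hm.2

theorem monomial_one_eq_prod_toMultiset (m : V →₀ ℕ) :
    (monomial m 1 : MvPolynomial V K) = (m.toMultiset.map X).prod := by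
  rw [monomial_eq, C_1, one_mul, Finsupp.toMultiset_map, Finsupp.prod_toMultiset,
    Finsupp.prod_mapDomain_index (by simp) (by simp [pow_add])]

theorem toricHom_mul_sub_mul {F : Set V} {β : V → B} {w : V → ℕ} {a b c d : V}
    (h : a ∈ F ∧ b ∈ F ↔ c ∈ F ∧ d ∈ F)
    (hβ : a ∈ F → b ∈ F → ({β a, β b} : Multiset B) = {β c, β d} ∧ w a + w b = w c + w d) :
    toricHom K F β w (X a * X b - X c * X d) = 0 := by
  classical
  by_cases hab : a ∈ F ∧ b ∈ F
  · obtain ⟨hc, hd⟩ := h.1 hab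
    obtain ⟨h1, h2⟩ := hβ hab.1 hab.2
    have h3 : (X (some (β a)) * X (some (β b)) : MvPolynomial (Option B) K) =
        X (some (β c)) * X (some (β d)) := by
      simpa using
        congrArg (fun s => (s.map fun b => (X (some b) : MvPolynomial (Option B) K)).prod) h1
    simp only [toricHom, map_sub, map_mul, aeval_X, hab.1, hab.2, hc, hd, if_true]
    rw [sub_eq_zero]
    calc _ = (X (some (β a)) * X (some (β b))) * X none ^ (w a + w b) := by ring
      _ = _ := by rw [h3, h2]; ring
  · have hcd : ¬ (c ∈ F ∧ d ∈ F) := fun hc => hab (h.2 hc)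
    have : ∀ u v : V, ¬ (u ∈ F ∧ v ∈ F) → toricHom K F β w (X u * X v) = 0 := by
      intro u v huv
      rw [map_mul, mul_eq_zero]
      by_cases hu : u ∈ F
      · have hv : v ∉ F := fun hv => huv ⟨hu, hv⟩
        exact Or.inr (by simp [toricHom, hv])
      · exact Or.inl (by simp [toricHom, hu])
    rw [map_sub, this _ _ hab, this _ _ hcd, sub_zero]

end MvPolynomial

/-! ### The relations of the lattice and its two gradings -/

namespace DiamondLattice

variable {n k : ℕ} {A : Type*} [CommMonoid A]

/-- The relations imposed by the join-meet ideal on a family `g` of elements of a commutative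
monoid. Here and below `p` and `q` stand for the positions `k - 1` and `k`, so that
`x p < x q, z, y p < y q` is the diamond. -/
structure Relations (p q : Fin n) (g : DiamondLattice n k → A) : Prop where
  xy : ∀ i j, g (x i) * g (y j) = g (x j) * g (y i)
  zx : ∀ j : Fin n, k ≤ j.val → g z * g (x j) = g (x p) * g (y j)
  zy : ∀ i : Fin n, i.val < k → g z * g (y i) = g (x i) * g (y q)

/-- The column of a variable in the matrix with rows `x` and `y`; the variable `z` is a column of
its own. -/
def segreBlock : DiamondLattice n k → Option (Fin n)
  | x i => some i
  | y i => some i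
  | z => none

/-- The row of a variable in the matrix with rows `x` and `y`. -/
def segreWeight : DiamondLattice n k → ℕ
  | x _ => 0
  | y _ => 1
  | z => 0

/-- The block of a variable in the scroll obtained by identifying `z`, `x q` and `y p`: the columns
`p` and `q` merge into the block `x p, x q = y p = z, y q`, which is named `p`. -/
def scrollBlock (p q : Fin n) : DiamondLattice n k → Fin n
  | x i => if i = q then p else i
  | y i => if i = q then p else i
  | z => p

/-- The weight of a variable in its block of the scroll. In the merged block it is `0` for `x p`,
`1` for `x q`, `y p` and `z`, and `2` for `y q`; in the other blocks it is the row. -/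
def scrollWeight (q : Fin n) : DiamondLattice n k → ℕ
  | x i => if i = q then 1 else 0
  | y i => if i = q then 2 else 1
  | z => 1

variable {p q : Fin n} {g : DiamondLattice n k → A}

theorem Relations.prod_eq_of_segre (hg : Relations p q g) {s t : Multiset (DiamondLattice n k)}
    (hb : s.map segreBlock = t.map segreBlock)
    (hw : (s.map segreWeight).sum = (t.map segreWeight).sum) :
    (s.map g).prod = (t.map g).prod := by
  rw [← one_mul (s.map g).prod, ← one_mul (t.map g).prod]
  refine prod_eq_of_map_eq_of_sum_eq (fun b => if b = none then 0 else 1) ?_ ?_ ?_ hb hw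
  · rintro (i | i | _) <;> simp [segreBlock, segreWeight]
  · rintro (i | i | _) (j | j | _) <;> simp +contextual [segreBlock, segreWeight]
  · intro u v hu hv
    obtain ⟨i, rfl⟩ : ∃ i, u = x i := by
      rcases u with i | i | _ <;> simp [segreBlock, segreWeight] at hu ⊢
    obtain ⟨j, rfl⟩ : ∃ j, v = y j := by
      rcases v with j | j | _ <;> simp [segreWeight] at hv ⊢
    exact ⟨y i, x j, rfl, rfl, rfl, rfl, by rw [hg.xy, mul_comm (g (x j))]⟩

/-- The element `z - y p` is annihilated by `x i * y j` for `j` at or above the diamond. -/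
theorem Relations.mul_z_eq_mul_y (hg : Relations p q g) (i : Fin n) {j : Fin n}
    (hj : k ≤ j.val) : g (x i) * g (y j) * g z = g (x i) * g (y j) * g (y p) := by
  calc g (x i) * g (y j) * g z = g z * g (x j) * g (y i) := by rw [hg.xy]; ac_rfl
    _ = g (x p) * g (y i) * g (y j) := by rw [hg.zx j hj]; ac_rfl
    _ = g (x i) * g (y j) * g (y p) := by rw [hg.xy]; ac_rfl

/-- The element `z - x q` is annihilated by `x i * y j` for `i` below the diamond. -/
theorem Relations.mul_z_eq_mul_x (hg : Relations p q g) {i : Fin n} (j : Fin n)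
    (hi : i.val < k) : g (x i) * g (y j) * g z = g (x i) * g (y j) * g (x q) := by
  calc g (x i) * g (y j) * g z = g z * g (y i) * g (x j) := by rw [hg.xy]; ac_rfl
    _ = g (x i) * (g (x j) * g (y q)) := by rw [hg.zy i hi]; ac_rfl
    _ = g (x i) * g (y j) * g (x q) := by rw [hg.xy]; ac_rfl

/-- For `i < k ≤ j`, multiplication by `x i * y j` identifies `z`, `x q` and `y p`, so all relations
of the scroll hold after this multiplication. -/
theorem Relations.mul_prod_eq_of_scroll (hg : Relations p q g) (hp : p.val + 1 = k)
    (hq : q.val = k) {i j : Fin n} (hi : i.val < k)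
    (hj : k ≤ j.val) {s t : Multiset (DiamondLattice n k)}
    (hb : s.map (scrollBlock p q) = t.map (scrollBlock p q))
    (hw : (s.map (scrollWeight q)).sum = (t.map (scrollWeight q)).sum) :
    g (x i) * g (y j) * (s.map g).prod = g (x i) * g (y j) * (t.map g).prod := by
  have hpq : p ≠ q := by rintro rfl; omega
  have hzy := hg.mul_z_eq_mul_y i hj
  have hzx := hg.mul_z_eq_mul_x j hi
  set c := g (x i) * g (y j)
  refine prod_eq_of_map_eq_of_sum_eq (fun b => if b = p then 2 else 1) ?_ ?_ ?_ hb hw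
  · rintro (i | i | _) <;> simp only [scrollBlock, scrollWeight] <;> split_ifs <;> simp_all
  · rintro (i | i | _) (j | j | _) <;> simp only [scrollBlock, scrollWeight] <;>
      (try split_ifs) <;> simp_all
  · -- Modulo `c` the variable `z` may be replaced by `x q` or `y p`, so every exchange is a minor.
    have up : ∀ u : DiamondLattice n k, scrollWeight q u <
        (if scrollBlock p q u = p then 2 else 1) → ∃ a : Fin n, c * g u = c * g (x a) ∧
          scrollBlock p q (y a : DiamondLattice n k) = scrollBlock p q u ∧
          scrollWeight q (y a : DiamondLattice n k) = scrollWeight q u + 1 := by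
      rintro (a | a | _) h
      · refine ⟨a, rfl, rfl, ?_⟩
        simp only [scrollWeight]; split_ifs <;> rfl
      · have : a = p := by
          simp only [scrollBlock, scrollWeight] at h
          split_ifs at h <;> simp_all
        subst this
        exact ⟨q, by rw [← hzy, hzx], by simp [scrollBlock], by simp [scrollWeight, hpq]⟩
      · exact ⟨q, hzx, by simp [scrollBlock], by simp [scrollWeight]⟩
    have down : ∀ u : DiamondLattice n k, 0 < scrollWeight q u → ∃ a : Fin n,
        c * g u = c * g (y a) ∧
          scrollBlock p q (x a : DiamondLattice n k) = scrollBlock p q u ∧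
          scrollWeight q (x a : DiamondLattice n k) + 1 = scrollWeight q u := by
      rintro (a | a | _) h
      · have : a = q := by
          simp only [scrollWeight] at h
          split_ifs at h <;> simp_all
        subst this
        exact ⟨p, by rw [← hzy, hzx], by simp [scrollBlock], by simp [scrollWeight, hpq]⟩
      · refine ⟨a, rfl, rfl, ?_⟩
        simp only [scrollWeight]; split_ifs <;> rfl
      · exact ⟨p, hzy, by simp [scrollBlock], by simp [scrollWeight, hpq]⟩
    intro u v hu hv
    obtain ⟨a, ha, hab, haw⟩ := up u hu
    obtain ⟨b, hb, hbb, hbw⟩ := down v hv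
    refine ⟨y a, x b, hab, haw, hbb, hbw, ?_⟩
    calc c * (g u * g v) = c * g u * g v := by ac_rfl
      _ = c * g v * g (x a) := by rw [ha]; ac_rfl
      _ = c * (g (x a) * g (y b)) := by rw [hb]; ac_rfl
      _ = c * (g (y a) * g (x b)) := by rw [hg.xy, mul_comm (g (x b))]

/-! ### Faces, and monomials off the faces -/

/-- A set `F` of variables such that the homomorphism of the Segre grading that kills the variables
outside `F` kills the join-meet ideal: the two products in a generator `x i * y j - x j * y i` lie
in `F` together, and no product in another generator has both factors in `F`. -/
structure IsFace (p q : Fin n) (F : Set (DiamondLattice n k)) : Prop where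
  xy : ∀ i j, x i ∈ F → y j ∈ F → x j ∈ F ∧ y i ∈ F
  zx : ∀ j : Fin n, k ≤ j.val → z ∈ F → x j ∉ F
  xpy : ∀ j : Fin n, k ≤ j.val → x p ∈ F → y j ∉ F
  zy : ∀ i : Fin n, i.val < k → z ∈ F → y i ∉ F
  xyq : ∀ i : Fin n, i.val < k → x i ∈ F → y q ∉ F

/-- Six faces suffice to force a factor `x i * y j` with `i < k ≤ j`: the variables `x`, the
variables `y`, the two parts of the matrix on either side of position `k`, and `z` together with
the variables `x` below or the variables `y` above. -/
theorem exists_pair_of_not_isFace (hp : p.val + 1 = k) (hq : q.val = k)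
    (hg : Relations p q g) {s : Multiset (DiamondLattice n k)}
    (hs : ∀ F, IsFace p q F → ¬ ∀ v ∈ s, v ∈ F) :
    ∃ a ∈ s, ∃ b ∈ s, a ≠ b ∧ ∃ i j : Fin n, i.val < k ∧ k ≤ j.val ∧
      g a * g b = g (x i) * g (y j) := by
  have hX := hs {v | ∃ i, v = x i} (by constructor <;> simp)
  have hY := hs {v | ∃ i, v = y i} (by constructor <;> simp)
  have hlow := hs {v | ∃ i : Fin n, i.val < k ∧ (v = x i ∨ v = y i)} (by
    constructor <;> simp <;> omega)
  have hhigh := hs {v | ∃ i : Fin n, k ≤ i.val ∧ (v = x i ∨ v = y i)} (by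
    constructor <;> simp <;> omega)
  have hZx := hs {v | v = z ∨ ∃ i : Fin n, i.val < k ∧ v = x i} (by
    constructor <;> simp)
  have hZy := hs {v | v = z ∨ ∃ i : Fin n, k ≤ i.val ∧ v = y i} (by
    constructor <;> simp)
  push Not at hX hY hlow hhigh hZx hZy
  by_cases hz : z ∈ s
  · obtain ⟨a, ha, haz⟩ := hZy
    obtain ⟨b, hb, hbz⟩ := hZx
    rcases a with a | a | _
    · rcases le_or_gt k a.val with hak | hak
      · exact ⟨z, hz, x a, ha, by simp, p, a, by omega, hak, hg.zx a hak⟩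
      · rcases b with b | b | _
        · have hbk : k ≤ b.val := by by_contra h; exact hbz (Or.inr ⟨b, by omega, rfl⟩)
          exact ⟨z, hz, x b, hb, by simp, p, b, by omega, hbk, hg.zx b hbk⟩
        · rcases le_or_gt k b.val with hbk | hbk
          · exact ⟨x a, ha, y b, hb, by simp, a, b, hak, hbk, rfl⟩
          · exact ⟨z, hz, y b, hb, by simp, b, q, hbk, by omega, hg.zy b hbk⟩
        · exact absurd (Or.inl rfl) hbz
    · have hak : a.val < k := by by_contra h; exact haz (Or.inr ⟨a, by omega, rfl⟩)
      exact ⟨z, hz, y a, ha, by simp, a, q, hak, by omega, hg.zy a hak⟩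
    · exact absurd (Or.inl rfl) haz
  · obtain ⟨a, ha⟩ : ∃ a, x a ∈ s := by
      obtain ⟨v, hv, hvF⟩ := hY
      rcases v with v | v | _
      exacts [⟨v, hv⟩, absurd ⟨v, rfl⟩ hvF, absurd hv hz]
    obtain ⟨b, hb⟩ : ∃ b, y b ∈ s := by
      obtain ⟨v, hv, hvF⟩ := hX
      rcases v with v | v | _
      exacts [absurd ⟨v, rfl⟩ hvF, ⟨v, hv⟩, absurd hv hz]
    obtain ⟨c, hck, hc⟩ : ∃ c : Fin n, k ≤ c.val ∧ (x c ∈ s ∨ y c ∈ s) := by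
      obtain ⟨v, hv, hvF⟩ := hlow
      rcases v with v | v | _
      · exact ⟨v, by by_contra h; exact hvF ⟨v, by omega, Or.inl rfl⟩, Or.inl hv⟩
      · exact ⟨v, by by_contra h; exact hvF ⟨v, by omega, Or.inr rfl⟩, Or.inr hv⟩
      · exact absurd hv hz
    obtain ⟨d, hdk, hd⟩ : ∃ d : Fin n, d.val < k ∧ (x d ∈ s ∨ y d ∈ s) := by
      obtain ⟨v, hv, hvF⟩ := hhigh
      rcases v with v | v | _
      · exact ⟨v, by by_contra h; exact hvF ⟨v, by omega, Or.inl rfl⟩, Or.inl hv⟩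
      · exact ⟨v, by by_contra h; exact hvF ⟨v, by omega, Or.inr rfl⟩, Or.inr hv⟩
      · exact absurd hv hz
    rcases le_or_gt k a.val with hak | hak <;> rcases le_or_gt k b.val with hbk | hbk
    · rcases hd with hd | hd
      · exact ⟨x d, hd, y b, hb, by simp, d, b, hdk, hbk, rfl⟩
      · exact ⟨x a, ha, y d, hd, by simp, d, a, hdk, hak, hg.xy a d⟩
    · exact ⟨x a, ha, y b, hb, by simp, b, a, hbk, hak, hg.xy a b⟩
    · exact ⟨x a, ha, y b, hb, by simp, a, b, hak, hbk, rfl⟩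
    · rcases hc with hc | hc
      · exact ⟨x c, hc, y b, hb, by simp, b, c, hbk, hck, hg.xy c b⟩
      · exact ⟨x a, ha, y c, hc, by simp, a, c, hak, hck, rfl⟩

theorem exists_cons_cons_of_not_isFace (hp : p.val + 1 = k) (hq : q.val = k)
    (hg : Relations p q g) {s : Multiset (DiamondLattice n k)}
    (hs : ∀ F, IsFace p q F → ¬ ∀ v ∈ s, v ∈ F) :
    ∃ i j : Fin n, i.val < k ∧ k ≤ j.val ∧ ∃ t : Multiset (DiamondLattice n k),
      (s.map g).prod = ((x i ::ₘ y j ::ₘ t).map g).prod := by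
  obtain ⟨a, ha, b, hb, hab, i, j, hi, hj, h⟩ := exists_pair_of_not_isFace hp hq hg hs
  obtain ⟨s, rfl⟩ := Multiset.exists_cons_of_mem ha
  obtain ⟨s, rfl⟩ := Multiset.exists_cons_of_mem ((Multiset.mem_cons.1 hb).resolve_left hab.symm)
  exact ⟨i, j, hi, hj, s, by simp [← mul_assoc, h]⟩

/-- The low index `i'` in a factor `x i' * y j` can be replaced by any other low index `i` that
occurs in the product, unless `i = p`: the block `p` of the scroll does not come from `p` alone. -/
theorem Relations.exists_replace_low (hg : Relations p q g) (hq : q.val = k)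
    {i i' j : Fin n} (hi : i.val < k) (hip : i ≠ p) (hj : k ≤ j.val)
    {t : Multiset (DiamondLattice n k)}
    (hmem : i ∈ (x i' ::ₘ y j ::ₘ t).map (scrollBlock p q)) :
    ∃ t' : Multiset (DiamondLattice n k),
      ((x i' ::ₘ y j ::ₘ t).map g).prod = ((x i ::ₘ y j ::ₘ t').map g).prod := by
  have hiq : i ≠ q := by rintro rfl; omega
  have hij : i ≠ j := by rintro rfl; omega
  by_cases hii : i = i'
  · exact ⟨t, by rw [hii]⟩
  obtain ⟨v, hv, hvi⟩ := Multiset.mem_map.1 hmem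
  have hvt : v = x i ∨ v = y i := by
    rcases v with a | a | _ <;> simp only [scrollBlock] at hvi
    · left; split_ifs at hvi <;> simp_all
    · right; split_ifs at hvi <;> simp_all
    · exact absurd hvi.symm hip
  have hvt' : v ∈ t := by
    rcases hvt with rfl | rfl <;> simpa [hii, hij] using hv
  obtain ⟨t, rfl⟩ := Multiset.exists_cons_of_mem hvt'
  simp only [Multiset.map_cons, Multiset.prod_cons]
  rcases hvt with rfl | rfl
  · refine ⟨x i' ::ₘ t, ?_⟩
    simp only [Multiset.map_cons, Multiset.prod_cons]
    ac_rfl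
  · refine ⟨y i' ::ₘ t, ?_⟩
    simp only [Multiset.map_cons, Multiset.prod_cons]
    calc _ = (g (x i') * g (y i)) * (g (y j) * (t.map g).prod) := by ac_rfl
      _ = _ := by rw [hg.xy]; ac_rfl

/-- The high index `j'` in a factor `x i * y j'` can be replaced by any block `j` at or above
position `k` that occurs in the product. (The value `q` is not a block of the scroll.) -/
theorem Relations.exists_replace_high (hg : Relations p q g) (hp : p.val + 1 = k)
    {i j j' : Fin n} (hi : i.val < k) (hj : k ≤ j.val)
    {t : Multiset (DiamondLattice n k)}
    (hmem : j ∈ (x i ::ₘ y j' ::ₘ t).map (scrollBlock p q)) :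
    ∃ t' : Multiset (DiamondLattice n k),
      ((x i ::ₘ y j' ::ₘ t).map g).prod = ((x i ::ₘ y j ::ₘ t').map g).prod := by
  have hjp : j ≠ p := by rintro rfl; omega
  have hij : j ≠ i := by rintro rfl; omega
  by_cases hjj : j = j'
  · exact ⟨t, by rw [hjj]⟩
  obtain ⟨v, hv, hvj⟩ := Multiset.mem_map.1 hmem
  have hvt : v = x j ∨ v = y j := by
    rcases v with a | a | _ <;> simp only [scrollBlock] at hvj
    · left; split_ifs at hvj <;> simp_all
    · right; split_ifs at hvj <;> simp_all
    · exact absurd hvj.symm hjp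
  have hvt' : v ∈ t := by
    rcases hvt with rfl | rfl <;> simpa [hjj, hij] using hv
  obtain ⟨t, rfl⟩ := Multiset.exists_cons_of_mem hvt'
  simp only [Multiset.map_cons, Multiset.prod_cons]
  rcases hvt with rfl | rfl
  · refine ⟨x j' ::ₘ t, ?_⟩
    simp only [Multiset.map_cons, Multiset.prod_cons]
    calc _ = g (x i) * ((g (x j) * g (y j')) * (t.map g).prod) := by ac_rfl
      _ = _ := by rw [hg.xy]; ac_rfl
  · refine ⟨y j' ::ₘ t, ?_⟩
    simp only [Multiset.map_cons, Multiset.prod_cons]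
    ac_rfl

/-- Off the faces, the scroll grading separates the monomials. Both products contain a factor
`x i * y j` with `i < k ≤ j`. Their blocks agree, so these factors can be chosen equal, and then
multiplication by the common factor makes the relations of the scroll available. The hypothesis
`hdeg` says that the scroll grading is well defined on products. -/
theorem Relations.prod_eq_of_scroll (hg : Relations p q g) (hp : p.val + 1 = k) (hq : q.val = k)
    (hdeg : ∀ s t : Multiset (DiamondLattice n k), (s.map g).prod = (t.map g).prod →
      s.map (scrollBlock p q) = t.map (scrollBlock p q) ∧
        (s.map (scrollWeight q)).sum = (t.map (scrollWeight q)).sum)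
    {s t : Multiset (DiamondLattice n k)}
    (hs : ∀ F, IsFace p q F → ¬ ∀ v ∈ s, v ∈ F) (ht : ∀ F, IsFace p q F → ¬ ∀ v ∈ t, v ∈ F)
    (hb : s.map (scrollBlock p q) = t.map (scrollBlock p q))
    (hw : (s.map (scrollWeight q)).sum = (t.map (scrollWeight q)).sum) :
    (s.map g).prod = (t.map g).prod := by
  have hpq : p ≠ q := by rintro rfl; omega
  obtain ⟨i, j, hi, hj, s', hs'⟩ := exists_cons_cons_of_not_isFace hp hq hg hs
  obtain ⟨i', j', hi', hj', t', ht'⟩ := exists_cons_cons_of_not_isFace hp hq hg ht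
  have hblock : ∀ {u v : Multiset (DiamondLattice n k)}, (s.map g).prod = (u.map g).prod →
      (t.map g).prod = (v.map g).prod → u.map (scrollBlock p q) = v.map (scrollBlock p q) := by
    intro u v hu hv
    rw [← (hdeg _ _ hu).1, ← (hdeg _ _ hv).1, hb]
  have hlow : ∀ a : Fin n, a.val < k → scrollBlock p q (x a : DiamondLattice n k) = a := by
    intro a ha
    have : a ≠ q := by rintro rfl; omega
    simp [scrollBlock, this]
  have hhigh : ∀ a : Fin n, a ≠ q → scrollBlock p q (y a : DiamondLattice n k) = a := by
    intro a ha
    simp [scrollBlock, ha]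
  -- If an index is not the one merged into block `p`, it occurs in both products and can be moved
  -- into the factor of the other one; if neither can be moved, both indices are `p` (or `q`).
  obtain ⟨a, ha, s₁, t₁, hs₁, ht₁⟩ : ∃ a : Fin n, a.val < k ∧
      ∃ s₁ t₁ : Multiset (DiamondLattice n k),
        (s.map g).prod = ((x a ::ₘ y j ::ₘ s₁).map g).prod ∧
        (t.map g).prod = ((x a ::ₘ y j' ::ₘ t₁).map g).prod := by
    by_cases hip : i = p
    · by_cases hip' : i' = p
      · exact ⟨p, by omega, s', t', hip ▸ hs', hip' ▸ ht'⟩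
      · obtain ⟨s₁, hs₁⟩ := hg.exists_replace_low (i := i') (i' := i) hq hi' hip' hj (t := s') (by
          rw [hblock hs' ht', Multiset.map_cons, hlow _ hi']
          exact Multiset.mem_cons_self _ _)
        exact ⟨i', hi', s₁, t', hs'.trans hs₁, ht'⟩
    · obtain ⟨t₁, ht₁⟩ := hg.exists_replace_low (i := i) (i' := i') hq hi hip hj' (t := t') (by
        rw [← hblock hs' ht', Multiset.map_cons, hlow _ hi]
        exact Multiset.mem_cons_self _ _)
      exact ⟨i, hi, s', t₁, hs', ht'.trans ht₁⟩
  obtain ⟨b, hbk, s₂, t₂, hs₂, ht₂⟩ : ∃ b : Fin n, k ≤ b.val ∧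
      ∃ s₂ t₂ : Multiset (DiamondLattice n k),
        (s.map g).prod = ((x a ::ₘ y b ::ₘ s₂).map g).prod ∧
        (t.map g).prod = ((x a ::ₘ y b ::ₘ t₂).map g).prod := by
    by_cases hjq : j = q
    · by_cases hjq' : j' = q
      · exact ⟨q, by omega, s₁, t₁, hjq ▸ hs₁, hjq' ▸ ht₁⟩
      · obtain ⟨s₂, hs₂⟩ := hg.exists_replace_high (j := j') (j' := j) hp ha hj' (t := s₁) (by
          rw [hblock hs₁ ht₁, Multiset.map_cons, Multiset.map_cons, hhigh _ hjq']
          simp)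
        exact ⟨j', hj', s₂, t₁, hs₁.trans hs₂, ht₁⟩
    · obtain ⟨t₂, ht₂⟩ := hg.exists_replace_high (j := j) (j' := j') hp ha hj (t := t₁) (by
        rw [← hblock hs₁ ht₁, Multiset.map_cons, Multiset.map_cons, hhigh _ hjq]
        simp)
      exact ⟨j, hj, s₁, t₂, hs₁, ht₁.trans ht₂⟩
  have h1 := hblock hs₂ ht₂
  have h2 := (hdeg _ _ hs₂).2.symm.trans (hw.trans (hdeg _ _ ht₂).2)
  simp only [Multiset.map_cons, Multiset.cons_inj_right, Multiset.sum_cons,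
    Nat.add_left_cancel_iff] at h1 h2
  rw [hs₂, ht₂]
  simpa [mul_assoc] using hg.mul_prod_eq_of_scroll hp hq ha hbk h1 h2

/-! ### Radicality of the join-meet ideal -/

open MvPolynomial

variable (K : Type*) [Field K]

theorem joinMeetIdeal_le (hk : 1 ≤ k) (hkn : k + 1 ≤ n) (hp : p.val + 1 = k) (hq : q.val = k)
    {J : Ideal (MvPolynomial (DiamondLattice n k) K)}
    (hxy : ∀ i j, X (x i) * X (y j) - X (x j) * X (y i) ∈ J)
    (hzx : ∀ j : Fin n, k ≤ j.val → X z * X (x j) - X (x p) * X (y j) ∈ J)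
    (hzy : ∀ i : Fin n, i.val < k → X z * X (y i) - X (x i) * X (y q) ∈ J) :
    letI := lattice (n := n) hk hkn
    joinMeetIdeal K (DiamondLattice n k) ≤ J := by
  refine Ideal.span_le.2 ?_
  rintro _ ⟨a, b, hab, hba, rfl⟩
  change ¬ DiamondLattice.le a b at hab
  change ¬ DiamondLattice.le b a at hba
  change X a * X b - X (DiamondLattice.inf hkn a b) * X (DiamondLattice.sup hkn a b) ∈ J
  have hp' : (⟨k - 1, by omega⟩ : Fin n) = p := Fin.ext (by simp; omega)
  have hq' : (⟨k, hkn⟩ : Fin n) = q := Fin.ext hq.symm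
  rcases a with i | i | _ <;> rcases b with j | j | _ <;>
    simp only [DiamondLattice.le, DiamondLattice.inf, DiamondLattice.sup, not_le, not_lt,
      not_true_eq_false, hp', hq'] at hab hba ⊢
  · exact absurd hab hba.not_gt
  · rw [min_eq_right hab.le, max_eq_left hab.le]
    exact hxy i j
  · rw [if_neg (by omega), min_eq_right (Fin.le_def.2 (by omega)), mul_comm]
    exact hzx i hab
  · rw [min_eq_left hba.le, max_eq_right hba.le, mul_comm (X (y i))]
    exact hxy j i
  · exact absurd hab hba.not_gt
  · rw [if_neg (by omega), max_eq_right (Fin.le_def.2 (by omega)), mul_comm]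
    exact hzy i hba
  · rw [if_neg (by omega), min_eq_right (Fin.le_def.2 (by omega))]
    exact hzx j hba
  · rw [if_neg (by omega), max_eq_right (Fin.le_def.2 (by omega))]
    exact hzy j hab

theorem relations_mk (hk : 1 ≤ k) (hkn : k + 1 ≤ n) (hp : p.val + 1 = k) (hq : q.val = k) :
    letI := lattice (n := n) hk hkn
    Relations p q fun v : DiamondLattice n k =>
      Ideal.Quotient.mk (joinMeetIdeal K (DiamondLattice n k)) (X v) := by
  let _ := lattice (n := n) hk hkn
  have hp' : (⟨k - 1, by omega⟩ : Fin n) = p := Fin.ext (by simp; omega)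
  have hq' : (⟨k, hkn⟩ : Fin n) = q := Fin.ext hq.symm
  have hgen : ∀ a b : DiamondLattice n k, ¬ DiamondLattice.le a b → ¬ DiamondLattice.le b a →
      Ideal.Quotient.mk (joinMeetIdeal K (DiamondLattice n k)) (X a) *
        Ideal.Quotient.mk (joinMeetIdeal K (DiamondLattice n k)) (X b) =
      Ideal.Quotient.mk (joinMeetIdeal K (DiamondLattice n k)) (X (DiamondLattice.inf hkn a b)) *
        Ideal.Quotient.mk (joinMeetIdeal K (DiamondLattice n k))
          (X (DiamondLattice.sup hkn a b)) := by
    intro a b hab hba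
    rw [← map_mul, ← map_mul, Ideal.Quotient.eq]
    exact Ideal.subset_span ⟨a, b, hab, hba, rfl⟩
  have hlt : ∀ i j : Fin n, i < j →
      Ideal.Quotient.mk (joinMeetIdeal K (DiamondLattice n k)) (X (x j)) *
        Ideal.Quotient.mk (joinMeetIdeal K (DiamondLattice n k)) (X (y i)) =
      Ideal.Quotient.mk (joinMeetIdeal K (DiamondLattice n k)) (X (x i)) *
        Ideal.Quotient.mk (joinMeetIdeal K (DiamondLattice n k)) (X (y j)) := by
    intro i j hij
    have := hgen (x j) (y i) hij.not_ge id
    simpa only [DiamondLattice.inf, DiamondLattice.sup, min_eq_right hij.le,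
      max_eq_left hij.le] using this
  refine ⟨fun i j => ?_, fun j hj => ?_, fun i hi => ?_⟩
  · rcases lt_trichotomy i j with h | rfl | h
    exacts [(hlt i j h).symm, rfl, hlt j i h]
  · have := hgen z (x j) id (by simpa [DiamondLattice.le] using hj)
    simpa only [DiamondLattice.inf, DiamondLattice.sup, hp', if_neg hj.not_gt,
      min_eq_right (Fin.le_def.2 (by omega : p.val ≤ j.val))] using this
  · have := hgen z (y i) (by simpa [DiamondLattice.le] using hi) id
    simpa only [DiamondLattice.inf, DiamondLattice.sup, hq', if_neg hi.not_ge,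
      max_eq_right (Fin.le_def.2 (by omega : i.val ≤ q.val))] using this

theorem joinMeetIdeal_le_ker_segre (hk : 1 ≤ k) (hkn : k + 1 ≤ n) (hp : p.val + 1 = k)
    (hq : q.val = k) {F : Set (DiamondLattice n k)} (hF : IsFace p q F) :
    letI := lattice (n := n) hk hkn
    joinMeetIdeal K (DiamondLattice n k) ≤
      RingHom.ker (toricHom K F segreBlock segreWeight) := by
  refine joinMeetIdeal_le K hk hkn hp hq (fun i j => ?_) (fun j hj => ?_) (fun i hi => ?_) <;>
    refine toricHom_mul_sub_mul ?_ ?_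
  · exact ⟨fun h => hF.xy i j h.1 h.2, fun h => hF.xy j i h.1 h.2⟩
  · exact fun _ _ => ⟨Multiset.pair_comm _ _, rfl⟩
  · exact ⟨fun h => absurd h.2 (hF.zx j hj h.1), fun h => absurd h.2 (hF.xpy j hj h.1)⟩
  · exact fun h h' => absurd h' (hF.zx j hj h)
  · exact ⟨fun h => absurd h.2 (hF.zy i hi h.1), fun h => absurd h.2 (hF.xyq i hi h.1)⟩
  · exact fun h h' => absurd h' (hF.zy i hi h)

theorem joinMeetIdeal_le_ker_scroll (hk : 1 ≤ k) (hkn : k + 1 ≤ n) (hp : p.val + 1 = k)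
    (hq : q.val = k) :
    letI := lattice (n := n) hk hkn
    joinMeetIdeal K (DiamondLattice n k) ≤
      RingHom.ker (toricHom K Set.univ (scrollBlock p q) (scrollWeight q)) := by
  have hpq : p ≠ q := by rintro rfl; omega
  refine joinMeetIdeal_le K hk hkn hp hq (fun i j => ?_) (fun j hj => ?_) (fun i hi => ?_) <;>
    refine toricHom_mul_sub_mul (by simp) fun _ _ => ?_
  · refine ⟨Multiset.pair_comm _ _, ?_⟩
    simp only [scrollWeight]
    split_ifs <;> rfl
  · refine ⟨by simp [scrollBlock], ?_⟩
    simp only [scrollWeight, if_neg hpq]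
    split_ifs <;> rfl
  · have : i ≠ q := by rintro rfl; omega
    exact ⟨by simpa [scrollBlock] using Multiset.pair_comm _ _, by simp [scrollWeight, this]⟩

theorem isRadical_joinMeetIdeal (hk : 1 ≤ k) (hkn : k + 1 ≤ n) :
    letI := lattice (n := n) hk hkn
    (joinMeetIdeal K (DiamondLattice n k)).IsRadical := by
  classical
  let _ := lattice (n := n) hk hkn
  obtain ⟨p, hp⟩ : ∃ p : Fin n, p.val + 1 = k := ⟨⟨k - 1, by omega⟩, by simp; omega⟩
  obtain ⟨q, hq⟩ : ∃ q : Fin n, q.val = k := ⟨⟨k, hkn⟩, rfl⟩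
  set I := joinMeetIdeal K (DiamondLattice n k) with hI
  have hg := relations_mk K hk hkn hp hq
  rw [← hI] at hg
  set g : DiamondLattice n k → MvPolynomial (DiamondLattice n k) K ⧸ I :=
    fun v => Ideal.Quotient.mk I (X v)
  have hmk : ∀ m : DiamondLattice n k →₀ ℕ,
      Ideal.Quotient.mk I (monomial m 1) = (m.toMultiset.map g).prod := by
    intro m
    rw [monomial_one_eq_prod_toMultiset, map_multiset_prod, Multiset.map_map]
    rfl
  have hscroll := joinMeetIdeal_le_ker_scroll K hk hkn hp hq
  -- Congruent monomials have the same exponent in the scroll.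
  have hdeg : ∀ s t : Multiset (DiamondLattice n k), (s.map g).prod = (t.map g).prod →
      s.map (scrollBlock p q) = t.map (scrollBlock p q) ∧
        (s.map (scrollWeight q)).sum = (t.map (scrollWeight q)).sum := by
    intro s t hst
    have h := hmk s.toFinsupp
    rw [Multiset.toFinsupp_toMultiset, hst, ← Multiset.toFinsupp_toMultiset t, ← hmk,
      Ideal.Quotient.eq] at h
    have h := hscroll h
    rw [RingHom.mem_ker, map_sub, toricHom_monomial, toricHom_monomial, if_pos (Set.subset_univ _),
      if_pos (Set.subset_univ _), sub_eq_zero, monomial_left_inj one_ne_zero,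
      toricExponent_eq_iff] at h
    simpa using h
  intro f hf
  induction hN : f.support.card using Nat.strong_induction_on generalizing f with
  | _ N ih =>
    by_cases hface : ∃ F, IsFace p q F ∧ ∃ m ∈ f.support, (m.support : Set (DiamondLattice n k)) ⊆ F
    · -- The part of `f` on a face lies in `I` and can be discarded.
      obtain ⟨F, hF, m₀, hm₀, hm₀F⟩ := hface
      have hfF : toricHom K F segreBlock segreWeight f = 0 :=
        (RingHom.ker_isPrime _).isRadical.radical_le_iff.2
          (joinMeetIdeal_le_ker_segre K hk hkn hp hq hF) hf
      have hpart := sum_filter_mem_of_toricHom_eq_zero (I := I) hfF fun m _ m' _ h => by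
        rw [← Ideal.Quotient.eq, hmk, hmk]
        rw [toricExponent_eq_iff] at h
        exact hg.prod_eq_of_segre h.1 h.2
      have hsplit : (∑ m ∈ f.support with (m.support : Set (DiamondLattice n k)) ⊆ F,
          monomial m (f.coeff m)) +
          ∑ m ∈ f.support with ¬ (m.support : Set (DiamondLattice n k)) ⊆ F,
            monomial m (f.coeff m) = f := by
        rw [Finset.sum_filter_add_sum_filter_not, support_sum_monomial_coeff]
      set f₁ := ∑ m ∈ f.support with (m.support : Set (DiamondLattice n k)) ⊆ F,
        monomial m (f.coeff m)
      set f₂ := ∑ m ∈ f.support with ¬ (m.support : Set (DiamondLattice n k)) ⊆ F,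
        monomial m (f.coeff m)
      have hlt : f₂.support.card < N := by
        rw [← hN]
        refine Finset.card_lt_card (Finset.ssubset_of_subset_of_ssubset (s₂ :=
          f.support.filter fun m => ¬ (m.support : Set (DiamondLattice n k)) ⊆ F) ?_
          (Finset.filter_ssubset.2 ⟨m₀, hm₀, not_not.2 hm₀F⟩))
        refine (support_sum).trans (Finset.biUnion_subset.2 fun m hm => ?_)
        exact support_monomial_subset.trans (Finset.singleton_subset_iff.2 hm)
      rw [← hsplit]
      refine I.add_mem hpart (ih _ hlt ?_ rfl)
      rw [← hsplit] at hf
      exact (Ideal.add_mem_iff_right _ (Ideal.le_radical hpart)).1 hf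
    · -- No monomial of `f` is supported on a face: only the scroll sees `f`.
      push Not at hface
      have hf0 : toricHom K Set.univ (scrollBlock p q) (scrollWeight q) f = 0 :=
        (RingHom.ker_isPrime _).isRadical.radical_le_iff.2 hscroll hf
      have hnot : ∀ m ∈ f.support, ∀ F, IsFace p q F → ¬ ∀ v ∈ m.toMultiset, v ∈ F :=
        fun m hm F hF h => hface F hF m hm fun v hv => h v ((Finsupp.mem_toMultiset _ _).2 hv)
      have hall := sum_filter_mem_of_toricHom_eq_zero (I := I) hf0 fun m hm m' hm' h => by
        rw [← Ideal.Quotient.eq, hmk, hmk]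
        rw [toricExponent_eq_iff] at h
        exact hg.prod_eq_of_scroll hp hq hdeg (hnot m hm) (hnot m' hm') h.1 h.2
      rwa [Finset.filter_true_of_mem fun _ _ => Set.subset_univ _,
        support_sum_monomial_coeff] at hall

end DiamondLattice

theorem theorem3p3 (K : Type*) [Field K] (n k : ℕ) (hk : 1 ≤ k) (hkn : k + 1 ≤ n) :
    letI : Lattice (DiamondLattice n k) := DiamondLattice.lattice hk hkn
    (joinMeetIdeal K (DiamondLattice n k)).IsRadical := by
  exact DiamondLattice.isRadical_joinMeetIdeal K hk hkn
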